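/- Let $n\ge 1$, let $c\le d$ be real numbers and $A=[c,d]$. Let $X_1,\dots,X_n$ be mutually independent centered real-valued Gaussian processes indexed by $A$, with almost surely continuous sample paths, and let $Y_1,\dots,Y_n$ likewise be mutually independent centered real-valued Gaussian processes indexed by $A$ with almost surely continuous sample paths (the two families may be defined on different probability spaces, and if they are defined on the same one, nothing is assumed about their joint law). Suppose that for every $1\le i\le n$ $$\mathbb{E}\,X_i(t)^2=\mathbb{E}\,Y_i(t)^2\quad (t\in A),\qquad \mathbb{E}\,X_i(s)X_i(t)\ \ge\ \mathbb{E}\,Y_i(s)Y_i(t)\quad (s,t\in A).$$ Then for every $u>0$ $$\mathbb{P}\Big(\sup_{t\in A}\sum_{i=1}^n X_i(t)^2>u\Big)\ \le\ 2^n\,\mathbb{P}\Big(\sup_{t\in A}\sum_{i=1}^n Y_i(t)^2>u\Big).$$ -/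

import Mathlib

open MeasureTheory ProbabilityTheory

/-! By duality, the norm of X(t) exceeds √u iff some vector w satisfies ⟨w, X(t)⟩ > √u‖w‖. Write w =
e·v with e a sign vector and v ≥ 0. For fixed e, the Gaussian process (t, v) ↦ ∑ e_i v_i X_i(t) has
covariance ∑ v_i v'_i E X_i(s)X_i(t): the signs cancel and the weights are nonnegative. It therefore
has the same variances as (t, v) ↦ ∑ v_i Y_i(t) and larger covariances. Slepian's inequality bounds
its exceedance probability by that of the Y process, and a union bound over the 2^n sign vectors
gives the factor. Path continuity reduces everything to countably many (t, v).

Slepian's inequality is proved by rotating X into an independent Y. The sign of the derivative comes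
from Gaussian regression (`integral_mul_comp_nonneg`), so first derivatives of the test functions
suffice. -/

/-- If `W` is centered, jointly Gaussian with the vector `Z` and negatively correlated with its
coordinates, and if `G` is antitone in the coordinates that are correlated with `W`, then
`W` and `G(Z)` are positively correlated. -/
theorem ProbabilityTheory.HasGaussianLaw.integral_mul_comp_nonneg
    {Ω ι : Type*} [MeasurableSpace Ω] {P : Measure Ω} [Finite ι] {W : Ω → ℝ} {Z : ι → Ω → ℝ}
    (h : HasGaussianLaw (fun ω => (W ω, fun i => Z i ω)) P) (hW : ∫ ω, W ω ∂P = 0)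
    {G : (ι → ℝ) → ℝ} (hGm : Measurable G) {C : ℝ} (hG : ∀ z, |G z| ≤ C)
    (hcov : ∀ i, cov[W, Z i; P] ≤ 0)
    (hmono : ∀ z z' : ι → ℝ, (∀ i, cov[W, Z i; P] = 0 → z i = z' i) → z ≤ z' → G z' ≤ G z) :
    0 ≤ ∫ ω, W ω * G (fun i => Z i ω) ∂P := by
  have := h.isProbabilityMeasure
  have := Fintype.ofFinite ι
  have hWg : HasGaussianLaw W P := h.fst
  have hZg : HasGaussianLaw (fun ω => fun i => Z i ω) P := h.snd
  have hW2 : MemLp W 2 P := hWg.memLp_two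
  have hZ2 (i) : MemLp (Z i) 2 P := (hZg.eval i).memLp_two
  by_cases hv : Var[W; P] = 0
  · have h0 : W =ᵐ[P] 0 := by
      have := (variance_eq_integral hWg.aemeasurable).symm.trans hv
      rw [hW, integral_eq_zero_iff_of_nonneg (fun ω => by positivity)
        (by simpa using hW2.integrable_sq)] at this
      filter_upwards [this] with ω hω
      simpa using hω
    rw [integral_eq_zero_of_ae]
    filter_upwards [h0] with ω hω
    simp [hω]
  have hvpos : 0 < Var[W; P] := lt_of_le_of_ne (variance_nonneg _ _) (Ne.symm hv)
  -- Regression on `W`: the residual `V` is uncorrelated with `W`, hence independent of it by joint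
  -- Gaussianity.
  set a : ι → ℝ := fun i => cov[W, Z i; P] / Var[W; P] with ha
  let V : ι → Ω → ℝ := fun i ω => Z i ω - a i * W ω
  let L : (ℝ × (ι → ℝ)) →L[ℝ] (Unit → ℝ) × (ι → ℝ) :=
    (ContinuousLinearMap.pi fun _ => ContinuousLinearMap.fst ℝ ℝ (ι → ℝ)).prod
      (ContinuousLinearMap.pi fun i =>
        (ContinuousLinearMap.proj i).comp (ContinuousLinearMap.snd ℝ ℝ (ι → ℝ)) -
          a i • ContinuousLinearMap.fst ℝ ℝ (ι → ℝ))
  have hWV : HasGaussianLaw (fun ω => (fun _ : Unit => W ω, fun i => V i ω)) P := h.map_fun L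
  have hind := hWV.indepFun_of_covariance_eval (fun _ i => by
    change cov[W, fun ω => Z i ω - a i * W ω; P] = 0
    rw [covariance_fun_sub_right hW2 (hZ2 i) (hW2.const_mul _), covariance_const_mul_right,
      covariance_self hWg.aemeasurable, ha]
    field_simp
    ring)
  have hind' : IndepFun W (fun ω => G (fun i => V i ω)) P :=
    hind.comp (φ := fun f : Unit → ℝ => f ()) (measurable_pi_apply _) hGm
  have hVm : AEMeasurable (fun ω => fun i => V i ω) P := hWV.snd.aemeasurable
  have hGV : AEStronglyMeasurable (fun ω => G (fun i => V i ω)) P :=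
    (hGm.comp_aemeasurable hVm).aestronglyMeasurable
  have hGZ : AEStronglyMeasurable (fun ω => G (fun i => Z i ω)) P :=
    (hGm.comp_aemeasurable hZg.aemeasurable).aestronglyMeasurable
  have h0 : ∫ ω, W ω * G (fun i => V i ω) ∂P = 0 := by
    rw [hind'.integral_fun_mul_eq_mul_integral hWg.aemeasurable.aestronglyMeasurable hGV, hW,
      zero_mul]
  rw [← h0]
  -- Pointwise, W·G(V) ≤ W·G(Z): since `a` ≤ 0, passing from `V` to `Z` = `V` + `a` `W` lowers the
  -- coordinates when `W` ≥ 0 and raises them when `W` ≤ 0.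
  refine integral_mono
    (hWg.integrable.mul_bdd hGV (.of_forall fun ω => by simpa using hG _))
    (hWg.integrable.mul_bdd hGZ (.of_forall fun ω => by simpa using hG _)) fun ω => ?_
  have ha0 (i) : a i ≤ 0 := div_nonpos_of_nonpos_of_nonneg (hcov i) hvpos.le
  have haz (i) (hi : cov[W, Z i; P] = 0) : a i = 0 := by simp [ha, hi]
  rcases le_total 0 (W ω) with hw | hw
  · refine mul_le_mul_of_nonneg_left (hmono _ _ (fun i hi => ?_) fun i => ?_) hw
    · simp [V, haz i hi]
    · have := mul_nonpos_of_nonpos_of_nonneg (ha0 i) hw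
      simp only [V]; linarith
  · refine mul_le_mul_of_nonpos_left (hmono _ _ (fun i hi => ?_) fun i => ?_) hw
    · simp [V, haz i hi]
    · have := mul_nonneg_of_nonpos_of_nonpos (ha0 i) hw
      simp only [V]; linarith

/-- Slepian's comparison for products of smooth antitone functions. -/
theorem ProbabilityTheory.HasGaussianLaw.integral_prod_le
    {Ω ι : Type*} [MeasurableSpace Ω] {P : Measure Ω} [Fintype ι] {X Y : ι → Ω → ℝ}
    (h : HasGaussianLaw (fun ω => (fun i => X i ω, fun i => Y i ω)) P)
    (hX : ∀ i, ∫ ω, X i ω ∂P = 0) (hY : ∀ i, ∫ ω, Y i ω ∂P = 0)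
    (hXY : ∀ i j, cov[X i, Y j; P] = 0)
    (hvar : ∀ i, cov[X i, X i; P] = cov[Y i, Y i; P])
    (hcov : ∀ i j, cov[Y i, Y j; P] ≤ cov[X i, X j; P])
    {f f' : ι → ℝ → ℝ} (hf : ∀ i x, HasDerivAt (f i) (f' i x) x)
    (hf0 : ∀ i x, 0 ≤ f i x) (hf1 : ∀ i x, f i x ≤ 1) (hf'm : ∀ i, Measurable (f' i))
    (hf'0 : ∀ i x, f' i x ≤ 0) {K : ℝ} (hK : ∀ i x, -K ≤ f' i x) :
    ∫ ω, ∏ i, f i (Y i ω) ∂P ≤ ∫ ω, ∏ i, f i (X i ω) ∂P := by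
  classical
  have := h.isProbabilityMeasure
  have hXi (i) : HasGaussianLaw (X i) P := h.fst.eval i
  have hYi (i) : HasGaussianLaw (Y i) P := h.snd.eval i
  have hX2 (i) := (hXi i).memLp_two
  have hY2 (i) := (hYi i).memLp_two
  have hfm (i) : Measurable (f i) :=
    (continuous_iff_continuousAt.2 fun x => (hf i x).continuousAt).measurable
  have hanti (i) : Antitone (f i) := antitone_of_hasDerivAt_nonpos (hf i) (hf'0 i)
  -- The rotation runs from `X` at θ = 0 to `Y` at θ = π/2, and `W` is the θ-derivative of `Z`.
  let Z : ι → ℝ → Ω → ℝ := fun i θ ω => Real.cos θ * X i ω + Real.sin θ * Y i ω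
  let W : ι → ℝ → Ω → ℝ := fun i θ ω => -Real.sin θ * X i ω + Real.cos θ * Y i ω
  let G : ι → (ι → ℝ) → ℝ := fun j z => -f' j (z j) * ∏ i ∈ Finset.univ.erase j, f i (z i)
  have hP0 (s : Finset ι) (z : ι → ℝ) : 0 ≤ ∏ i ∈ s, f i (z i) :=
    Finset.prod_nonneg fun i _ => hf0 i _
  have hP1 (s : Finset ι) (z : ι → ℝ) : ∏ i ∈ s, f i (z i) ≤ 1 :=
    Finset.prod_le_one (fun i _ => hf0 i _) fun i _ => hf1 i _
  have hGm (j) : Measurable (G j) := by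
    exact ((hf'm j).comp (measurable_pi_apply j)).neg.mul
      (Finset.measurable_prod _ fun i _ => (hfm i).comp (measurable_pi_apply i))
  have hGb (j) (z) : |G j z| ≤ K := by
    rw [abs_mul, abs_of_nonneg (hP0 _ z), abs_of_nonneg (by linarith [hf'0 j (z j)])]
    nlinarith [hf'0 j (z j), hK j (z j), hP1 (Finset.univ.erase j) z]
  -- Coordinate j is frozen because `f' j` need not be monotone. This is enough: equal variances
  -- make `W j` and `Z j` uncorrelated.
  have hGmono (j) (z z' : ι → ℝ) (hj : z j = z' j) (hz : z ≤ z') : G j z' ≤ G j z := by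
    simp only [G, hj]
    exact mul_le_mul_of_nonneg_left
      (Finset.prod_le_prod (fun i _ => hf0 i _) fun i _ => hanti i (hz i))
      (by linarith [hf'0 j (z' j)])
  have hWZ (j) (θ) : HasGaussianLaw (fun ω => (W j θ ω, fun i => Z i θ ω)) P := by
    let x (i : ι) : ((ι → ℝ) × (ι → ℝ)) →L[ℝ] ℝ :=
      (ContinuousLinearMap.proj i).comp (ContinuousLinearMap.fst ℝ _ _)
    let y (i : ι) : ((ι → ℝ) × (ι → ℝ)) →L[ℝ] ℝ :=
      (ContinuousLinearMap.proj i).comp (ContinuousLinearMap.snd ℝ _ _)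
    exact h.map_fun ((-Real.sin θ • x j + Real.cos θ • y j).prod
      (ContinuousLinearMap.pi fun i => Real.cos θ • x i + Real.sin θ • y i))
  have hZm (θ) : AEMeasurable (fun ω => fun i => Z i θ ω) P := by
    refine aemeasurable_pi_lambda _ fun i => ?_
    exact ((hXi i).aemeasurable.const_mul _).add ((hYi i).aemeasurable.const_mul _)
  have hWcov (j i) (θ) : cov[W j θ, Z i θ; P] =
      Real.sin θ * Real.cos θ * (cov[Y j, Y i; P] - cov[X j, X i; P]) := by
    have h1 (c : ℝ) (i) : MemLp (fun ω => c * X i ω) 2 P := (hX2 i).const_mul c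
    have h2 (c : ℝ) (i) : MemLp (fun ω => c * Y i ω) 2 P := (hY2 i).const_mul c
    change cov[(fun ω => -Real.sin θ * X j ω) + (fun ω => Real.cos θ * Y j ω),
      (fun ω => Real.cos θ * X i ω) + (fun ω => Real.sin θ * Y i ω); P] = _
    rw [covariance_add_left (h1 _ _) (h2 _ _) ((h1 _ _).add (h2 _ _)),
      covariance_add_right (h1 _ _) (h1 _ _) (h2 _ _),
      covariance_add_right (h2 _ _) (h1 _ _) (h2 _ _)]
    simp only [covariance_const_mul_left, covariance_const_mul_right, hXY,
      covariance_comm (Y j) (X i)]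
    ring
  let F : ℝ → Ω → ℝ := fun θ ω => ∏ i, f i (Z i θ ω)
  let F' : ℝ → Ω → ℝ := fun θ ω => ∑ j, -(W j θ ω * G j (fun i => Z i θ ω))
  have hdiff (ω) (θ) : HasDerivAt (F · ω) (F' θ ω) θ := by
    have hz (i) : HasDerivAt (fun θ => Z i θ ω) (W i θ ω) θ :=
      ((Real.hasDerivAt_cos θ).mul_const _).add ((Real.hasDerivAt_sin θ).mul_const _)
    refine (HasDerivAt.fun_finsetProd (u := Finset.univ)
      (fun i _ => (hf i _).comp θ (hz i))).congr_deriv ?_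
    refine Finset.sum_congr rfl fun j _ => ?_
    simp only [G, smul_eq_mul, Function.comp]
    ring
  have hFm (θ) : AEStronglyMeasurable (F θ) P := by
    have : Measurable fun z : ι → ℝ => ∏ i, f i (z i) :=
      Finset.measurable_prod _ fun i _ => (hfm i).comp (measurable_pi_apply i)
    exact (this.comp_aemeasurable (hZm θ)).aestronglyMeasurable
  have hFi (θ) : Integrable (F θ) P :=
    Integrable.of_bound (hFm θ) 1 (.of_forall fun ω => by
      rw [Real.norm_of_nonneg (hP0 _ _)]; exact hP1 _ _)
  have hGZm (j θ) : AEStronglyMeasurable (fun ω => G j (fun i => Z i θ ω)) P :=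
    ((hGm j).comp_aemeasurable (hZm θ)).aestronglyMeasurable
  have hWGi (j θ) : Integrable (fun ω => W j θ ω * G j (fun i => Z i θ ω)) P :=
    (hWZ j θ).fst.integrable.mul_bdd (c := K) (hGZm j θ) (.of_forall fun ω => by simpa using hGb j fun i => Z i θ ω)
  have hderiv (θ) : HasDerivAt (fun θ => ∫ ω, F θ ω ∂P) (∫ ω, F' θ ω ∂P) θ := by
    refine (hasDerivAt_integral_of_dominated_loc_of_deriv_le (s := Set.univ)
      (bound := fun ω => ∑ j, (|X j ω| + |Y j ω|) * K) Filter.univ_mem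
      (.of_forall hFm) (hFi θ)
      (integrable_finsetSum _ fun j _ => (hWGi j θ).neg).aestronglyMeasurable
      (.of_forall fun ω θ _ => ?_)
      (integrable_finsetSum _ fun j _ =>
        (((hXi j).integrable.abs).add (hYi j).integrable.abs).mul_const K)
      (.of_forall fun ω θ _ => hdiff ω θ)).2
    refine (norm_sum_le _ _).trans (Finset.sum_le_sum fun j _ => ?_)
    rw [norm_neg, norm_mul, Real.norm_eq_abs, Real.norm_eq_abs]
    refine mul_le_mul ?_ (hGb j fun i => Z i θ ω) (abs_nonneg _) (by positivity)
    refine (abs_add_le _ _).trans (add_le_add ?_ ?_)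
    · rw [abs_mul, abs_neg]
      exact mul_le_of_le_one_left (abs_nonneg _) (Real.abs_sin_le_one θ)
    · rw [abs_mul]
      exact mul_le_of_le_one_left (abs_nonneg _) (Real.abs_cos_le_one θ)
  have hneg (θ) (hθ : θ ∈ Set.Icc 0 (Real.pi / 2)) : ∫ ω, F' θ ω ∂P ≤ 0 := by
    have hsum : ∫ ω, F' θ ω ∂P = ∑ j, ∫ ω, -(W j θ ω * G j (fun i => Z i θ ω)) ∂P :=
      integral_finsetSum _ fun j _ => (hWGi j θ).neg
    rw [hsum]
    refine Finset.sum_nonpos fun j _ => ?_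
    rw [integral_neg, neg_nonpos]
    refine (hWZ j θ).integral_mul_comp_nonneg ?_ (hGm j) (hGb j) (fun i => ?_)
      fun z z' hz hzz => hGmono j z z' (hz j ?_) hzz
    · change ∫ ω, (-Real.sin θ * X j ω + Real.cos θ * Y j ω) ∂P = 0
      rw [integral_add ((hXi j).integrable.const_mul _) ((hYi j).integrable.const_mul _),
        integral_const_mul, integral_const_mul, hX, hY]
      simp
    · rw [hWcov]
      exact mul_nonpos_of_nonneg_of_nonpos (mul_nonneg
        (Real.sin_nonneg_of_nonneg_of_le_pi hθ.1 (by linarith [hθ.2, Real.pi_pos]))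
        (Real.cos_nonneg_of_neg_pi_div_two_le_of_le (by linarith [hθ.1, Real.pi_pos]) hθ.2))
        (sub_nonpos.2 (hcov j i))
    · rw [hWcov, hvar, sub_self, mul_zero]
  have hanti : AntitoneOn (fun θ => ∫ ω, F θ ω ∂P) (Set.Icc 0 (Real.pi / 2)) := by
    refine antitoneOn_of_deriv_nonpos (convex_Icc _ _)
      (fun θ _ => (hderiv θ).continuousAt.continuousWithinAt)
      (fun θ _ => (hderiv θ).differentiableAt.differentiableWithinAt) fun θ hθ => ?_
    rw [(hderiv θ).deriv]
    exact hneg θ (interior_subset hθ)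
  have := hanti (Set.left_mem_Icc.2 Real.pi_div_two_pos.le)
    (Set.right_mem_Icc.2 Real.pi_div_two_pos.le) Real.pi_div_two_pos.le
  simpa [F, Z] using this

/-- The shift by m, dominated by m² away from 0, forces the limit 1 at y = 0, so the smooth
approximations converge everywhere to the indicator of the closed half-line. -/
theorem Real.tendsto_sigmoid_threshold (y : ℝ) :
    Filter.Tendsto (fun m : ℕ => Real.sigmoid ((m : ℝ) ^ 2 * y + m)) Filter.atTop
      (nhds (if 0 ≤ y then 1 else 0)) := by
  have hm : Filter.Tendsto (fun m : ℕ => (m : ℝ)) Filter.atTop Filter.atTop :=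
    tendsto_natCast_atTop_atTop
  split_ifs with hy
  · refine Real.tendsto_sigmoid_atTop.comp (Filter.tendsto_atTop_mono (fun m => ?_) hm)
    have := mul_nonneg (sq_nonneg (m : ℝ)) hy
    linarith
  · push Not at hy
    refine Real.tendsto_sigmoid_atBot.comp ?_
    have h1 : Filter.Tendsto (fun m : ℕ => (m : ℝ) * y + 1) Filter.atTop Filter.atBot :=
      Filter.tendsto_atBot_add_const_right _ _ (hm.atTop_mul_const_of_neg hy)
    refine (hm.atTop_mul_atBot₀ h1).congr fun m => ?_
    ring

/-! ### Slepian's inequality: vectors, then countable processes -/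

/-- Slepian's inequality for two uncorrelated, jointly Gaussian random vectors. -/
theorem ProbabilityTheory.HasGaussianLaw.measure_exists_gt_le_of_uncorrelated
    {Ω ι : Type*} [MeasurableSpace Ω] {P : Measure Ω} [Finite ι] {X Y : ι → Ω → ℝ}
    (h : HasGaussianLaw (fun ω => (fun i => X i ω, fun i => Y i ω)) P)
    (hX : ∀ i, ∫ ω, X i ω ∂P = 0) (hY : ∀ i, ∫ ω, Y i ω ∂P = 0)
    (hXY : ∀ i j, cov[X i, Y j; P] = 0)
    (hvar : ∀ i, cov[X i, X i; P] = cov[Y i, Y i; P])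
    (hcov : ∀ i j, cov[Y i, Y j; P] ≤ cov[X i, X j; P]) (lam : ι → ℝ) :
    P {ω | ∃ i, lam i < X i ω} ≤ P {ω | ∃ i, lam i < Y i ω} := by
  classical
  have := h.isProbabilityMeasure
  have := Fintype.ofFinite ι
  let f : ℕ → ι → ℝ → ℝ := fun m i x => Real.sigmoid ((m : ℝ) ^ 2 * (lam i - x) + m)
  have hfc (m i) : Continuous (f m i) := continuous_sigmoid.comp (by fun_prop)
  let f' : ℕ → ι → ℝ → ℝ := fun m i x => f m i x * (1 - f m i x) * (-(m : ℝ) ^ 2)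
  have hf (m i x) : HasDerivAt (f m i) (f' m i x) x := by
    refine (Real.hasDerivAt_sigmoid _).comp x ?_
    simpa using (((hasDerivAt_id x).const_sub (lam i)).const_mul ((m : ℝ) ^ 2)).add_const (m : ℝ)
  have hf0 (m i x) : 0 ≤ f m i x := Real.sigmoid_nonneg _
  have hf1 (m i x) : f m i x ≤ 1 := Real.sigmoid_le_one _
  have hle (m : ℕ) := h.integral_prod_le hX hY hXY hvar hcov (hf m) (hf0 m) (hf1 m)
    (fun i => (((hfc m i).mul (continuous_const.sub (hfc m i))).mul continuous_const).measurable)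
    (fun i x => by
      have := mul_nonneg (hf0 m i x) (sub_nonneg.2 (hf1 m i x))
      have := mul_nonneg this (sq_nonneg (m : ℝ))
      simp only [f']; linarith)
    (K := (m : ℝ) ^ 2) (fun i x => by
      have : f m i x * (1 - f m i x) ≤ 1 := by nlinarith [hf0 m i x, hf1 m i x]
      have := mul_le_mul_of_nonneg_right this (sq_nonneg (m : ℝ))
      simp only [f']; linarith)
  have hnull {V : ι → Ω → ℝ} (hV : ∀ i, AEMeasurable (V i) P) :
      NullMeasurableSet {ω | ∀ i, V i ω ≤ lam i} P := by
    rw [Set.ofPred_forall]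
    exact .iInter fun i => nullMeasurableSet_le (hV i) aemeasurable_const
  have hlim {V : ι → Ω → ℝ} (hV : ∀ i, AEMeasurable (V i) P) :
      Filter.Tendsto (fun m => ∫ ω, ∏ i, f m i (V i ω) ∂P) Filter.atTop
        (nhds (P.real {ω | ∀ i, V i ω ≤ lam i})) := by
    have e : P.real {ω | ∀ i, V i ω ≤ lam i} =
        ∫ ω, {ω | ∀ i, V i ω ≤ lam i}.indicator (fun _ => (1 : ℝ)) ω ∂P := by
      rw [integral_indicator₀ (hnull hV)]
      simp
    rw [e]
    refine tendsto_integral_of_dominated_convergence (fun _ => 1) (fun m => ?_)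
      (integrable_const _) (fun m => .of_forall fun ω => ?_) (.of_forall fun ω => ?_)
    · exact (Finset.aemeasurable_fun_prod _ fun i _ =>
        (hfc m i).measurable.comp_aemeasurable (hV i)).aestronglyMeasurable
    · rw [Real.norm_of_nonneg (Finset.prod_nonneg fun i _ => hf0 m i _)]
      exact Finset.prod_le_one (fun i _ => hf0 m i _) fun i _ => hf1 m i _
    · convert tendsto_finsetProd Finset.univ
        (fun i _ => Real.tendsto_sigmoid_threshold (lam i - V i ω)) using 2
      rw [Finset.prod_ite_zero]
      simp [Set.indicator_apply]
  have hXm (i) : AEMeasurable (X i) P := (h.fst.eval i).aemeasurable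
  have hYm (i) : AEMeasurable (Y i) P := (h.snd.eval i).aemeasurable
  have hreal := le_of_tendsto_of_tendsto' (hlim hYm) (hlim hXm) hle
  have hcompl (V : ι → Ω → ℝ) : {ω | ∃ i, lam i < V i ω} = {ω | ∀ i, V i ω ≤ lam i}ᶜ := by
    ext ω; simp
  rw [hcompl, hcompl, prob_compl_eq_one_sub₀ (hnull hXm), prob_compl_eq_one_sub₀ (hnull hYm)]
  exact tsub_le_tsub_left ((ENNReal.toReal_le_toReal (measure_ne_top _ _)
    (measure_ne_top _ _)).1 hreal) 1

/-- Slepian's inequality for centered Gaussian random vectors. -/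
theorem ProbabilityTheory.HasGaussianLaw.measure_exists_gt_le
    {Ω Ω' ι : Type*} [MeasurableSpace Ω] [MeasurableSpace Ω'] {P : Measure Ω} {P' : Measure Ω'}
    [Finite ι] {X : ι → Ω → ℝ} {Y : ι → Ω' → ℝ}
    (hXg : HasGaussianLaw (fun ω i => X i ω) P) (hYg : HasGaussianLaw (fun ω i => Y i ω) P')
    (hX : ∀ i, ∫ ω, X i ω ∂P = 0) (hY : ∀ i, ∫ ω, Y i ω ∂P' = 0)
    (hvar : ∀ i, cov[X i, X i; P] = cov[Y i, Y i; P'])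
    (hcov : ∀ i j, cov[Y i, Y j; P'] ≤ cov[X i, X j; P]) (lam : ι → ℝ) :
    P {ω | ∃ i, lam i < X i ω} ≤ P' {ω | ∃ i, lam i < Y i ω} := by
  have := Fintype.ofFinite ι
  have := hXg.isProbabilityMeasure
  have := hYg.isProbabilityMeasure
  -- On the product space the two vectors become independent, hence jointly Gaussian and
  -- uncorrelated, with unchanged laws.
  have h1 : MeasurePreserving Prod.fst (P.prod P') P := measurePreserving_fst
  have h2 : MeasurePreserving Prod.snd (P.prod P') P' := measurePreserving_snd
  have hXm (i) : AEMeasurable (X i) P := (hXg.eval i).aemeasurable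
  have hYm (i) : AEMeasurable (Y i) P' := (hYg.eval i).aemeasurable
  have gX : HasGaussianLaw (fun (p : Ω × Ω') i => X i p.1) (P.prod P') := by
    constructor
    have := hXg.isGaussian_map
    rwa [← h1.map_eq, AEMeasurable.map_map_of_aemeasurable
      (by rw [h1.map_eq]; exact hXg.aemeasurable) h1.aemeasurable] at this
  have gY : HasGaussianLaw (fun (p : Ω × Ω') i => Y i p.2) (P.prod P') := by
    constructor
    have := hYg.isGaussian_map
    rwa [← h2.map_eq, AEMeasurable.map_map_of_aemeasurable
      (by rw [h2.map_eq]; exact hYg.aemeasurable) h2.aemeasurable] at this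
  have iX (i) : ∫ p, X i p.1 ∂(P.prod P') = 0 := by
    rw [← hX i, ← h1.map_eq, integral_map h1.aemeasurable, h1.map_eq]
    rw [h1.map_eq]; exact (hXm i).aestronglyMeasurable
  have iY (i) : ∫ p, Y i p.2 ∂(P.prod P') = 0 := by
    rw [← hY i, ← h2.map_eq, integral_map h2.aemeasurable, h2.map_eq]
    rw [h2.map_eq]; exact (hYm i).aestronglyMeasurable
  have cX (i j) : cov[fun p => X i p.1, fun p => X j p.1; P.prod P'] = cov[X i, X j; P] := by
    conv_rhs => rw [← h1.map_eq]
    rw [covariance_map_fun _ _ h1.aemeasurable] <;> rw [h1.map_eq] <;>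
      exact (hXm _).aestronglyMeasurable
  have cY (i j) : cov[fun p => Y i p.2, fun p => Y j p.2; P.prod P'] = cov[Y i, Y j; P'] := by
    conv_rhs => rw [← h2.map_eq]
    rw [covariance_map_fun _ _ h2.aemeasurable] <;> rw [h2.map_eq] <;>
      exact (hYm _).aestronglyMeasurable
  have key := (IndepFun.hasGaussianLaw gX gY
    (indepFun_prod₀ hXg.aemeasurable hYg.aemeasurable)).measure_exists_gt_le_of_uncorrelated iX iY
    (fun i j => (indepFun_prod₀ (hXm i) (hYm j)).covariance_eq_zero
      (gX.eval i).memLp_two (gY.eval j).memLp_two)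
    (fun i => by rw [cX, cY, hvar]) (fun i j => by rw [cX, cY]; exact hcov i j) lam
  have nX : NullMeasurableSet {ω | ∃ i, lam i < X i ω} P := by
    rw [Set.ofPred_exists]
    exact .iUnion fun i => nullMeasurableSet_lt aemeasurable_const (hXm i)
  have nY : NullMeasurableSet {ω | ∃ i, lam i < Y i ω} P' := by
    rw [Set.ofPred_exists]
    exact .iUnion fun i => nullMeasurableSet_lt aemeasurable_const (hYm i)
  rwa [← h1.measure_preimage nX, ← h2.measure_preimage nY]

/-- Slepian's inequality for centered Gaussian processes with a countable index set. -/
theorem ProbabilityTheory.IsGaussianProcess.measure_exists_gt_le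
    {Ω Ω' ι : Type*} [MeasurableSpace Ω] [MeasurableSpace Ω'] {P : Measure Ω} {P' : Measure Ω'}
    [Countable ι] {X : ι → Ω → ℝ} {Y : ι → Ω' → ℝ}
    (hXg : IsGaussianProcess X P) (hYg : IsGaussianProcess Y P')
    (hX : ∀ i, ∫ ω, X i ω ∂P = 0) (hY : ∀ i, ∫ ω, Y i ω ∂P' = 0)
    (hvar : ∀ i, cov[X i, X i; P] = cov[Y i, Y i; P'])
    (hcov : ∀ i j, cov[Y i, Y j; P'] ≤ cov[X i, X j; P]) (lam : ι → ℝ) :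
    P {ω | ∃ i, lam i < X i ω} ≤ P' {ω | ∃ i, lam i < Y i ω} := by
  have hU : {ω | ∃ i, lam i < X i ω} = ⋃ I : Finset ι, {ω | ∃ i : I, lam i < X i ω} := by
    ext ω
    simp only [Set.mem_ofPred_eq, Set.mem_iUnion, Subtype.exists, exists_prop]
    exact ⟨fun ⟨i, hi⟩ => ⟨{i}, i, by simp, hi⟩, fun ⟨_, i, _, hi⟩ => ⟨i, hi⟩⟩
  have hmono : Monotone fun I : Finset ι => {ω | ∃ i : I, lam i < X i ω} :=
    fun I J hIJ ω ⟨i, hi⟩ => ⟨⟨i, hIJ i.2⟩, hi⟩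
  rw [hU, hmono.directed_le.measure_iUnion]
  refine iSup_le fun I => ?_
  refine ((hXg.hasGaussianLaw I).measure_exists_gt_le (X := fun (i : I) => X i)
    (Y := fun (i : I) => Y i) (hYg.hasGaussianLaw I) (fun i => hX i) (fun i => hY i)
    (fun i => hvar i) (fun i j => hcov i j) (fun i => lam i)).trans (measure_mono ?_)
  exact fun ω ⟨i, hi⟩ => ⟨i, hi⟩

/-! ### Weighted sums of independent Gaussian processes -/

section LinearCombination

variable {Ω T κ S : Type*} [MeasurableSpace Ω] {P : Measure Ω} [Fintype κ] {X : κ → T → Ω → ℝ}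

theorem ProbabilityTheory.IsGaussianProcess.sum_mul_of_iIndepFun
    (hX : ∀ i, IsGaussianProcess (X i) P) (hind : iIndepFun (fun i ω t => X i t ω) P)
    (a : κ → S → ℝ) (t : S → T) :
    IsGaussianProcess (fun k ω => ∑ i, a i k * X i (t k) ω) P := by
  constructor
  intro I
  have h1 (i) : HasGaussianLaw (fun ω (k : I) => X i (t k) ω) P :=
    ((hX i).comp_right t).hasGaussianLaw I
  have h2 : iIndepFun (fun i ω (k : I) => X i (t k) ω) P :=
    hind.comp (fun _ f (k : I) => f (t k)) fun _ =>
      measurable_pi_lambda _ fun k => measurable_pi_apply _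
  let L : (κ → I → ℝ) →L[ℝ] I → ℝ := ContinuousLinearMap.pi fun k =>
    ∑ i, a i k • ((ContinuousLinearMap.proj k).comp
      (ContinuousLinearMap.proj i : (κ → I → ℝ) →L[ℝ] I → ℝ) : (κ → I → ℝ) →L[ℝ] ℝ)
  refine ((h2.hasGaussianLaw h1).map_fun L).congr (.of_forall fun ω => funext fun k => ?_)
  simp [L, Finset.restrict]

/-- Independence kills the cross terms, so the weights enter only through the products `a i * b i`;
a sign common to both disappears. -/
theorem ProbabilityTheory.IsGaussianProcess.covariance_sum_mul_of_iIndepFun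
    (hX : ∀ i, IsGaussianProcess (X i) P) (hX0 : ∀ i t, ∫ ω, X i t ω ∂P = 0)
    (hind : iIndepFun (fun i ω t => X i t ω) P) (a b : κ → ℝ) (s t : T) :
    cov[fun ω => ∑ i, a i * X i s ω, fun ω => ∑ i, b i * X i t ω; P] =
      ∑ i, a i * b i * ∫ ω, X i s ω * X i t ω ∂P := by
  classical
  have := hind.isProbabilityMeasure
  have h2 (i t) : MemLp (X i t) 2 P := ((hX i).hasGaussianLaw_eval t).memLp_two
  rw [covariance_fun_sum_fun_sum (fun i => (h2 i s).const_mul _) fun i => (h2 i t).const_mul _]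
  refine Finset.sum_congr rfl fun i _ => ?_
  rw [Finset.sum_eq_single i]
  · rw [covariance_const_mul_left, covariance_const_mul_right, covariance_eq_sub (h2 i s) (h2 i t),
      hX0, hX0, mul_zero, sub_zero, mul_assoc]
    rfl
  · intro j _ hji
    have : IndepFun (X i s) (X j t) P :=
      (hind.indepFun hji.symm).comp (measurable_pi_apply s) (measurable_pi_apply t)
    rw [covariance_const_mul_left, covariance_const_mul_right,
      this.covariance_eq_zero (h2 i s) (h2 j t), mul_zero, mul_zero]
  · simp

theorem ProbabilityTheory.IsGaussianProcess.integral_sum_mul_eq_zero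
    (hX : ∀ i, IsGaussianProcess (X i) P) (hX0 : ∀ i t, ∫ ω, X i t ω ∂P = 0)
    (a : κ → ℝ) (t : T) : ∫ ω, ∑ i, a i * X i t ω ∂P = 0 := by
  rw [integral_finsetSum _ fun i _ => ((hX i).hasGaussianLaw_eval t).integrable.const_mul _]
  simp [integral_const_mul, hX0]

end LinearCombination

/-! ### Linearizing the Euclidean norm -/

/-- If the Euclidean norm of a continuous vector-valued function exceeds `r` somewhere, then after
flipping signs of coordinates its scalar product with some member `v` of a dense family of
nonnegative vectors exceeds `r * ‖v‖` at some member of a dense family of points. -/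
theorem exists_sign_lt_sum_of_denseRange {T κ S : Type*} [TopologicalSpace T] [Fintype κ]
    {x : κ → T → ℝ} (hx : ∀ i, Continuous (x i)) {u : ℝ} (hu : 0 ≤ u) {t : T}
    (ht : u < ∑ i, x i t ^ 2) {q : S → T × (κ → NNReal)} (hq : DenseRange q) :
    ∃ (e : κ → ℤˣ) (k : S), √u * √(∑ i, ((q k).2 i : ℝ) ^ 2) <
      ∑ i, ((e i : ℤ) : ℝ) * ((q k).2 i : ℝ) * x i (q k).1 := by
  let e : κ → ℤˣ := fun i => if 0 ≤ x i t then 1 else -1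
  have he (i) : ((e i : ℤ) : ℝ) * x i t = |x i t| := by
    simp only [e]
    split_ifs with h
    · simp [abs_of_nonneg h]
    · simp [abs_of_neg (not_le.1 h)]
  have hopen : IsOpen {p : T × (κ → NNReal) | √u * √(∑ i, (p.2 i : ℝ) ^ 2) <
      ∑ i, ((e i : ℤ) : ℝ) * (p.2 i : ℝ) * x i p.1} :=
    isOpen_lt (by fun_prop) (by fun_prop)
  -- The witness v = |x(t)| with the signs `e` of x(t) gives equality in Cauchy–Schwarz; the strict
  -- inequality then persists on an open set, which the dense family meets.
  obtain ⟨k, hk⟩ := hq.exists_mem_open hopen ⟨(t, fun i => ‖x i t‖₊), by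
    have hs (i) : ((e i : ℤ) : ℝ) * |x i t| * x i t = x i t ^ 2 := by
      rw [mul_right_comm, he, abs_mul_abs_self, sq]
    have hpos : 0 < ∑ i, x i t ^ 2 := hu.trans_lt ht
    simp only [Set.mem_ofPred_eq, coe_nnnorm, Real.norm_eq_abs, sq_abs, hs]
    calc √u * √(∑ i, x i t ^ 2) < √(∑ i, x i t ^ 2) * √(∑ i, x i t ^ 2) :=
          mul_lt_mul_of_pos_right (Real.sqrt_lt_sqrt hu ht) (Real.sqrt_pos.2 hpos)
      _ = ∑ i, x i t ^ 2 := Real.mul_self_sqrt hpos.le⟩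
  exact ⟨e, k, hk⟩

theorem lt_sum_sq_of_sqrt_mul_sqrt_lt {κ : Type*} [Fintype κ] {u : ℝ} {v x : κ → ℝ}
    (h : √u * √(∑ i, v i ^ 2) < ∑ i, v i * x i) : u < ∑ i, x i ^ 2 := by
  have h1 := h.trans_le (Real.sum_mul_le_sqrt_mul_sqrt Finset.univ v x)
  rw [mul_comm] at h1
  exact (Real.sqrt_lt_sqrt_iff_of_pos (Real.sqrt_pos.1
    ((Real.sqrt_nonneg u).trans_lt (lt_of_mul_lt_mul_left h1 (Real.sqrt_nonneg _))))).1
    (lt_of_mul_lt_mul_left h1 (Real.sqrt_nonneg _))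

/-! ### The comparison of suprema -/

theorem mainTheorem9 {Ω Ω' : Type*} [MeasurableSpace Ω] [MeasurableSpace Ω']
    (P : Measure Ω) [IsProbabilityMeasure P] (P' : Measure Ω') [IsProbabilityMeasure P']
    (n : ℕ) (c d : ℝ) (hcd : c ≤ d)
    (X : Fin n → Set.Icc c d → Ω → ℝ) (Y : Fin n → Set.Icc c d → Ω' → ℝ)
    (hXgauss : ∀ i, IsGaussianProcess (X i) P)
    (hYgauss : ∀ i, IsGaussianProcess (Y i) P')
    (hXcentered : ∀ i t, ∫ ω, X i t ω ∂P = 0)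
    (hYcentered : ∀ i t, ∫ ω, Y i t ω ∂P' = 0)
    (hXindep : iIndepFun (fun i ω t => X i t ω) P)
    (hYindep : iIndepFun (fun i ω t => Y i t ω) P')
    (hXcont : ∀ i, ∀ᵐ ω ∂P, Continuous (fun t => X i t ω))
    (hYcont : ∀ i, ∀ᵐ ω ∂P', Continuous (fun t => Y i t ω))
    (hvar : ∀ i t, ∫ ω, X i t ω ^ 2 ∂P = ∫ ω, Y i t ω ^ 2 ∂P')
    (hcov : ∀ i s t, ∫ ω, Y i s ω * Y i t ω ∂P' ≤ ∫ ω, X i s ω * X i t ω ∂P)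
    (u : ℝ) (hu : 0 < u) :
    P {ω | (u : EReal) < ⨆ t : Set.Icc c d, ((∑ i, X i t ω ^ 2 : ℝ) : EReal)} ≤
      2 ^ n * P' {ω | (u : EReal) < ⨆ t : Set.Icc c d, ((∑ i, Y i t ω ^ 2 : ℝ) : EReal)} := by
  have : Nonempty (Set.Icc c d) := ⟨⟨c, le_rfl, hcd⟩⟩
  let q : ℕ → Set.Icc c d × (Fin n → NNReal) := TopologicalSpace.denseSeq _
  have hq : DenseRange q := TopologicalSpace.denseRange_denseSeq _
  let lam : ℕ → ℝ := fun k => √u * √(∑ i, ((q k).2 i : ℝ) ^ 2)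
  let a : (Fin n → ℤˣ) → Fin n → ℕ → ℝ := fun e i k => ((e i : ℤ) : ℝ) * ((q k).2 i : ℝ)
  let b : Fin n → ℕ → ℝ := fun i k => ((q k).2 i : ℝ)
  have hab (e i k l) : a e i k * a e i l = b i k * b i l := by
    have : ((e i : ℤ) : ℝ) * ((e i : ℤ) : ℝ) = 1 := by
      rcases Int.units_eq_one_or (e i) with h | h <;> simp [h]
    simp only [a, b]
    rw [mul_mul_mul_comm, this, one_mul]
  have hslep (e) : P {ω | ∃ k, lam k < ∑ i, a e i k * X i (q k).1 ω} ≤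
      P' {ω | ∃ k, lam k < ∑ i, b i k * Y i (q k).1 ω} := by
    refine (IsGaussianProcess.sum_mul_of_iIndepFun hXgauss hXindep (a e) fun k =>
      (q k).1).measure_exists_gt_le
      (IsGaussianProcess.sum_mul_of_iIndepFun hYgauss hYindep b fun k => (q k).1)
      (fun k => IsGaussianProcess.integral_sum_mul_eq_zero hXgauss hXcentered (a e · k) _)
      (fun k => IsGaussianProcess.integral_sum_mul_eq_zero hYgauss hYcentered (b · k) _)
      (fun k => ?_) (fun k l => ?_) lam
    · rw [IsGaussianProcess.covariance_sum_mul_of_iIndepFun hXgauss hXcentered hXindep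
          (a e · k) (a e · k),
        IsGaussianProcess.covariance_sum_mul_of_iIndepFun hYgauss hYcentered hYindep
          (b · k) (b · k)]
      simp only [hab, ← sq, hvar]
    · rw [IsGaussianProcess.covariance_sum_mul_of_iIndepFun hXgauss hXcentered hXindep
          (a e · k) (a e · l),
        IsGaussianProcess.covariance_sum_mul_of_iIndepFun hYgauss hYcentered hYindep
          (b · k) (b · l)]
      refine Finset.sum_le_sum fun i _ => ?_
      rw [hab]
      -- Nonnegativity of the vectors v is needed here; arbitrary real weights could reverse the
      -- covariance inequality.
      exact mul_le_mul_of_nonneg_left (hcov _ _ _) (mul_nonneg (NNReal.coe_nonneg _)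
        (NNReal.coe_nonneg _))
  have hsub : {ω | (u : EReal) < ⨆ t : Set.Icc c d, ((∑ i, X i t ω ^ 2 : ℝ) : EReal)} ≤ᵐ[P]
      ⋃ e : Fin n → ℤˣ, {ω | ∃ k, lam k < ∑ i, a e i k * X i (q k).1 ω} := by
    filter_upwards [ae_all_iff.2 hXcont] with ω hω hlt
    obtain ⟨t, ht⟩ := lt_iSup_iff.1 hlt
    exact Set.mem_iUnion.2
      (exists_sign_lt_sum_of_denseRange hω hu.le (EReal.coe_lt_coe_iff.1 ht) hq)
  have hY : {ω | ∃ k, lam k < ∑ i, b i k * Y i (q k).1 ω} ⊆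
      {ω | (u : EReal) < ⨆ t : Set.Icc c d, ((∑ i, Y i t ω ^ 2 : ℝ) : EReal)} := by
    rintro ω ⟨k, hk⟩
    rw [Set.mem_ofPred_eq, lt_iSup_iff]
    exact ⟨(q k).1, EReal.coe_lt_coe_iff.2 (lt_sum_sq_of_sqrt_mul_sqrt_lt hk)⟩
  -- Each of the 2^n sign vectors contributes at most the same probability for `Y`.
  calc _ ≤ P (⋃ e : Fin n → ℤˣ, {ω | ∃ k, lam k < ∑ i, a e i k * X i (q k).1 ω}) :=
        measure_mono_ae hsub
    _ ≤ ∑ e : Fin n → ℤˣ, P {ω | ∃ k, lam k < ∑ i, a e i k * X i (q k).1 ω} :=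
        measure_iUnion_fintype_le _ _
    _ ≤ ∑ _e : Fin n → ℤˣ, P' _ := Finset.sum_le_sum fun e _ => (hslep e).trans (measure_mono hY)
    _ = _ := by simp
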